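/- There exist absolute constants $c, C > 0$ such that the following holds. Let $n > 10$ be an integer, let $0 < p < 1/2$, and let $\xi_1,\dots,\xi_n$ be i.i.d. Bernoulli$(p)$ random variables, indexed cyclically, so that $\xi_{n+1} = \xi_1$. Let $W = \sum_{i=1}^n \xi_i \xi_{i+1}$ be the number of 2-runs, let $\lambda = np^2$ (the mean of $W$), and let $Y$ be a Poisson random variable with mean $\lambda$. Then for every integer $k \ge \lambda$ such that, with $\xi = (k-\lambda)/\sqrt{\lambda}$, $$p + p\xi^2 + \frac{\xi^3}{\sqrt n} \le c,$$ we have $$\left| \frac{P(W \ge k)}{P(Y \ge k)} - 1 \right| \le C\left( p + p\xi^2 + \frac{\xi^3}{\sqrt n} \right).$$ -/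

import Mathlib

open MeasureTheory ProbabilityTheory

/-- The number of 2-runs `W = ∑ i, ξ i * ξ (i + 1)` of the sequence `ξ`, the indices being taken
cyclically: `finRotate n` sends `i` to `i + 1` for `i + 1 < n` and the last index to `0`. -/
def twoRuns {Ω : Type*} {n : ℕ} (ξ : Fin n → Ω → ℕ) (ω : Ω) : ℕ :=
  ∑ i : Fin n, ξ i ω * ξ (finRotate n i) ω

/-- The mean `λ = n p²` of the number of 2-runs. -/
noncomputable def twoRunsMean (n : ℕ) (p : unitInterval) : NNReal :=
  n * unitInterval.toNNReal p ^ 2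

/-- The standardized value `(k - λ) / √λ` with `λ = n p²`. -/
noncomputable def twoRunsXi (n : ℕ) (p : unitInterval) (k : ℕ) : ℝ :=
  ((k : ℝ) - twoRunsMean n p) / √(twoRunsMean n p : ℝ)

/-- The error term `p + p x² + x³ / √n` with `x = (k - λ) / √λ` and `λ = n p²`. -/
noncomputable def twoRunsError (n : ℕ) (p : unitInterval) (k : ℕ) : ℝ :=
  (p : ℝ) + p * twoRunsXi n p k ^ 2 + twoRunsXi n p k ^ 3 / √(n : ℝ)

/-! Put `z = k / λ` and weight the law of `W` by `z ^ W`. The same tilt turns the Poisson law of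
mean `λ` into the one of mean `k`, so the far tail becomes a central event. It remains to compare
the two normalising constants and to run Stein's method under the tilted law.

Both tasks rest on size biasing (`cycleMean_mul_self`): `E[W F(W)]` is `λ` times the mean of `F(W)`
given that one fixed pair of neighbours is `1, 1`. By `abs_pathSum_sub_cycleMean_le`, this
conditioning costs only `O(p B E[z ^ W])` when the increments of `F` are at most `B z ^ s`. For
`F(s) = t ^ s` this controls the logarithmic derivative of `G(t) = E[t ^ W]`, whence `log G(z) = λ(z
- 1) + O(p λ (z - 1)²)`. For `F(s) = z ^ (s + 1) f(s + 1)` it bounds the tilted Stein operator of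
mean `k`; here `f` solves the Stein equation for `h = tiltedTail z k`, chosen so that `z ^ W h(W)`
is `z ^ k` times the indicator of `W ≥ k`.

The lower bound `inv_le_tsum_tiltedTail` on the Poisson mean of `h` turns the additive Stein error
into a relative one. As `λ(z - 1)² = ξ²`, the total error is `O(p + p ξ²)`; the cubic term,
nonnegative for `k ≥ λ`, only enlarges the bound. -/

/-! ### Runs in words of independent bits -/

/-- The Bernoulli weight of a bit. -/
def bitWeight (p : ℝ) (a : Fin 2) : ℝ := if a = 0 then 1 - p else p

@[simp] lemma bitWeight_zero (p : ℝ) : bitWeight p 0 = 1 - p := rfl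

@[simp] lemma bitWeight_one (p : ℝ) : bitWeight p 1 = p := rfl

/-- The expectation of `F (number of runs)` over `m` independent bits placed between the two fixed
bits `a` and `b`. -/
def pathSum (p : ℝ) : ℕ → Fin 2 → Fin 2 → (ℕ → ℝ) → ℝ
  | 0, a, b, F => F (a * b)
  | m + 1, a, b, F => ∑ x, bitWeight p x * pathSum p m x b (fun s => F (a * x + s))

/-- The expectation of `g (last bit) (number of runs)` over `n` independent bits following the
fixed bit `a`. -/
def chainSum (p : ℝ) : ℕ → Fin 2 → (Fin 2 → ℕ → ℝ) → ℝ
  | 0, a, g => g a 0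
  | n + 1, a, g => ∑ x, bitWeight p x * chainSum p n x (fun l s => g l (a * x + s))

/-- The number of runs of a word of bits, read linearly. -/
def chainRuns {n : ℕ} (x : Fin (n + 1) → Fin 2) : ℕ :=
  ∑ i : Fin n, (x i.castSucc : ℕ) * (x i.succ : ℕ)

/-- The number of runs of a word of bits, read cyclically. -/
def cycleRuns {n : ℕ} (x : Fin n → Fin 2) : ℕ :=
  ∑ i : Fin n, (x i : ℕ) * (x (finRotate n i) : ℕ)

/-- The weight of a word of independent bits. -/
def wordWeight (p : ℝ) {n : ℕ} (x : Fin n → Fin 2) : ℝ := ∏ i, bitWeight p (x i)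

/-- The expectation of `F (number of cyclic runs)` over words of `n` independent bits. -/
def cycleMean (p : ℝ) (n : ℕ) (F : ℕ → ℝ) : ℝ :=
  ∑ x : Fin n → Fin 2, wordWeight p x * F (cycleRuns x)

lemma sum_cons {n : ℕ} (g : (Fin (n + 1) → Fin 2) → ℝ) :
    ∑ x, g x = ∑ a, ∑ x : Fin n → Fin 2, g (Fin.cons a x) := by
  rw [← Fintype.sum_prod_type']
  exact (Fintype.sum_equiv (Fin.consEquiv fun _ => Fin 2) _ _ fun _ => rfl).symm

lemma chainRuns_cons {n : ℕ} (a : Fin 2) (x : Fin (n + 1) → Fin 2) :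
    chainRuns (Fin.cons a x : Fin (n + 2) → Fin 2) = a * x 0 + chainRuns x := by
  unfold chainRuns
  rw [Fin.sum_univ_succ]
  simp

lemma wordWeight_cons (p : ℝ) {n : ℕ} (a : Fin 2) (x : Fin n → Fin 2) :
    wordWeight p (Fin.cons a x : Fin (n + 1) → Fin 2) = bitWeight p a * wordWeight p x := by
  simp [wordWeight, Fin.prod_univ_succ]

lemma sum_wordWeight_chainRuns (p : ℝ) (n : ℕ) (g : Fin 2 → Fin 2 → ℕ → ℝ) :
    ∑ x : Fin (n + 1) → Fin 2, wordWeight p x * g (x 0) (x (Fin.last n)) (chainRuns x)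
      = ∑ a, bitWeight p a * chainSum p n a (g a) := by
  induction n generalizing g with
  | zero =>
    rw [sum_cons]
    simp [wordWeight, chainRuns, chainSum]
  | succ n ih =>
    rw [sum_cons]
    refine Finset.sum_congr rfl fun a _ => ?_
    rw [chainSum, ← ih (fun x l s => g a l (a * x + s)), Finset.mul_sum]
    refine Finset.sum_congr rfl fun x _ => ?_
    rw [wordWeight_cons, chainRuns_cons, ← Fin.succ_last, Fin.cons_succ, Fin.cons_zero, mul_assoc]

lemma chainSum_succ_eq_pathSum (p : ℝ) (m : ℕ) (a : Fin 2) (g : Fin 2 → ℕ → ℝ) :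
    chainSum p (m + 1) a g = ∑ b, bitWeight p b * pathSum p m a b (g b) := by
  induction m generalizing a g with
  | zero => simp [chainSum, pathSum]
  | succ m ih =>
    rw [chainSum]
    simp only [ih, pathSum]
    simp only [Fin.sum_univ_two]
    ring

lemma cycleRuns_succ {n : ℕ} (x : Fin (n + 1) → Fin 2) :
    cycleRuns x = chainRuns x + (x (Fin.last n) : ℕ) * (x 0 : ℕ) := by
  unfold cycleRuns chainRuns
  rw [Fin.sum_univ_castSucc]
  simp

lemma sum_wordWeight_cycleRuns (p : ℝ) (m : ℕ) (g : Fin 2 → Fin 2 → ℕ → ℝ) :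
    ∑ x : Fin (m + 2) → Fin 2, wordWeight p x * g (x 0) (x (Fin.last _)) (cycleRuns x)
      = ∑ a, ∑ b, bitWeight p a * bitWeight p b * pathSum p m a b (fun s => g a b (s + b * a)) := by
  simp only [cycleRuns_succ]
  rw [sum_wordWeight_chainRuns p (m + 1) (fun a b s => g a b (s + b * a))]
  refine Finset.sum_congr rfl fun a _ => ?_
  rw [chainSum_succ_eq_pathSum, Finset.mul_sum]
  exact Finset.sum_congr rfl fun b _ => by ring

lemma cycleMean_eq_pathSum (p : ℝ) (m : ℕ) (F : ℕ → ℝ) :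
    cycleMean p (m + 2) F
      = ∑ a, ∑ b, bitWeight p a * bitWeight p b * pathSum p m a b (fun s => F (s + b * a)) :=
  sum_wordWeight_cycleRuns p m fun _ _ => F

/-! ### Rotation invariance and size biasing. -/

lemma cycleRuns_comp_finRotate {n : ℕ} (x : Fin n → Fin 2) :
    cycleRuns (x ∘ finRotate n) = cycleRuns x :=
  Equiv.sum_comp (finRotate n) fun i => (x i : ℕ) * (x (finRotate n i) : ℕ)

lemma wordWeight_comp_finRotate (p : ℝ) {n : ℕ} (x : Fin n → Fin 2) :
    wordWeight p (x ∘ finRotate n) = wordWeight p x :=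
  Equiv.prod_comp (finRotate n) fun i => bitWeight p (x i)

/-- The contribution of the pair of neighbours at `i` to the mean of `W F(W)`. -/
def edgeMean (p : ℝ) {n : ℕ} (i : Fin n) (F : ℕ → ℝ) : ℝ :=
  ∑ x : Fin n → Fin 2,
    wordWeight p x * (((x i : ℕ) * (x (finRotate n i) : ℕ) : ℕ) * F (cycleRuns x))

lemma edgeMean_finRotate (p : ℝ) {n : ℕ} (i : Fin n) (F : ℕ → ℝ) :
    edgeMean p (finRotate n i) F = edgeMean p i F := by
  refine Fintype.sum_equiv ((finRotate n).symm.arrowCongr (Equiv.refl _)) _ _ fun x => ?_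
  have : ((finRotate n).symm.arrowCongr (Equiv.refl (Fin 2))) x = x ∘ finRotate n := rfl
  rw [this, cycleRuns_comp_finRotate, wordWeight_comp_finRotate]
  rfl

lemma edgeMean_eq_zero_index (p : ℝ) {n : ℕ} (i : Fin (n + 1)) (F : ℕ → ℝ) :
    edgeMean p i F = edgeMean p (0 : Fin (n + 1)) F := by
  induction i using Fin.induction with
  | zero => rfl
  | succ i ih =>
    rw [← ih, ← edgeMean_finRotate p i.castSucc, finRotate_apply, Fin.coeSucc_eq_succ]

lemma edgeMean_last (p : ℝ) (m : ℕ) (F : ℕ → ℝ) :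
    edgeMean p (Fin.last (m + 1)) F = p ^ 2 * pathSum p m 1 1 (fun s => F (s + 1)) := by
  have h := sum_wordWeight_cycleRuns p m fun a b s => ((b * a : ℕ) : ℝ) * F s
  unfold edgeMean
  rw [finRotate_last, h]
  have h0 : ∀ m a b, pathSum p m a b (fun _ => 0) = 0 := by
    intro m
    induction m with
    | zero => intro a b; rfl
    | succ m ih => intro a b; simp [pathSum, ih]
  simp [Fin.sum_univ_two, h0, pow_two]

/-- By rotation invariance every edge contributes equally to `W F(W)`. The wrap-around edge is the
convenient one: fixing both its bits to `1` leaves a path between two ones, and the edge itself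
supplies the shift `s + 1`. -/
lemma cycleMean_mul_self (p : ℝ) (m : ℕ) (F : ℕ → ℝ) :
    cycleMean p (m + 2) (fun s => s * F s)
      = (m + 2) * p ^ 2 * pathSum p m 1 1 (fun s => F (s + 1)) := by
  have h : cycleMean p (m + 2) (fun s => s * F s) = ∑ i : Fin (m + 2), edgeMean p i F := by
    unfold cycleMean edgeMean
    rw [Finset.sum_comm]
    refine Finset.sum_congr rfl fun x _ => ?_
    rw [← Finset.mul_sum, ← Finset.sum_mul, ← Nat.cast_sum]
    rfl
  rw [h, Finset.sum_congr rfl fun i _ => (edgeMean_eq_zero_index p i F).trans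
    (edgeMean_eq_zero_index p (Fin.last _) F).symm, Finset.sum_const, edgeMean_last]
  simp
  ring

/-! ### Linearity, monotonicity and end effects for paths. -/

lemma bitWeight_nonneg {p : ℝ} (h0 : 0 ≤ p) (h1 : p ≤ 1) (a : Fin 2) : 0 ≤ bitWeight p a := by
  fin_cases a <;> simp [h0, h1]

lemma pathSum_sub (p : ℝ) (m : ℕ) (a b : Fin 2) (F H : ℕ → ℝ) :
    pathSum p m a b (fun s => F s - H s) = pathSum p m a b F - pathSum p m a b H := by
  induction m generalizing a F H with
  | zero => rfl
  | succ m ih => simp only [pathSum, ih, mul_sub, Finset.sum_sub_distrib]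

lemma pathSum_const_mul (p c : ℝ) (m : ℕ) (a b : Fin 2) (F : ℕ → ℝ) :
    pathSum p m a b (fun s => c * F s) = c * pathSum p m a b F := by
  induction m generalizing a F with
  | zero => rfl
  | succ m ih =>
    simp only [pathSum, ih, Finset.mul_sum]
    exact Finset.sum_congr rfl fun _ _ => by ring

lemma pathSum_mono {p : ℝ} (h0 : 0 ≤ p) (h1 : p ≤ 1) (m : ℕ) (a b : Fin 2) {F H : ℕ → ℝ} (h : ∀ s, F s ≤ H s) :
    pathSum p m a b F ≤ pathSum p m a b H := by
  induction m generalizing a F H with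
  | zero => exact h _
  | succ m ih =>
    exact Finset.sum_le_sum fun x _ =>
      mul_le_mul_of_nonneg_left (ih x fun s => h _) (bitWeight_nonneg h0 h1 x)

lemma abs_pathSum_le {p : ℝ} (h0 : 0 ≤ p) (h1 : p ≤ 1) (m : ℕ) (a b : Fin 2) {F H : ℕ → ℝ}
    (h : ∀ s, |F s| ≤ H s) : |pathSum p m a b F| ≤ pathSum p m a b H := by
  refine abs_le.2 ⟨?_, pathSum_mono h0 h1 m a b fun s => (abs_le.1 (h s)).2⟩
  have := pathSum_mono h0 h1 m a b (F := fun s => (-1) * H s) (H := F) fun s => by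
    linarith [(abs_le.1 (h s)).1]
  rw [pathSum_const_mul] at this
  linarith

lemma pathSum_mono_ends {p : ℝ} (h0 : 0 ≤ p) (h1 : p ≤ 1) (m : ℕ) {a a' b b' : Fin 2}
    (ha : a ≤ a') (hb : b ≤ b') {F : ℕ → ℝ} (hF : Monotone F) :
    pathSum p m a b F ≤ pathSum p m a' b' F := by
  induction m generalizing a a' F with
  | zero => exact hF (Nat.mul_le_mul ha hb)
  | succ m ih =>
    refine Finset.sum_le_sum fun x _ =>
      mul_le_mul_of_nonneg_left ?_ (bitWeight_nonneg h0 h1 x)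
    calc _ ≤ pathSum p m x b' (fun s => F (a * x + s)) :=
          ih le_rfl fun s t hst => hF (by omega)
      _ ≤ _ := pathSum_mono h0 h1 m x b' fun s =>
          hF (Nat.add_le_add_right (Nat.mul_le_mul_right _ ha) _)

/-- Flipping the end bit matters only if its neighbour is `1`, which has probability `p`, and then
it adds exactly one run. -/
lemma pathSum_left_sub (p : ℝ) (m : ℕ) (b : Fin 2) (F : ℕ → ℝ) :
    pathSum p (m + 1) 1 b F - pathSum p (m + 1) 0 b F
      = p * pathSum p m 1 b (fun s => F (s + 1) - F s) := by
  rw [pathSum_sub]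
  simp [pathSum, Fin.sum_univ_two, add_comm 1]
  ring

lemma pathSum_right_sub (p : ℝ) (m : ℕ) (a : Fin 2) (F : ℕ → ℝ) :
    pathSum p (m + 1) a 1 F - pathSum p (m + 1) a 0 F
      = p * pathSum p m a 1 (fun s => F (s + 1) - F s) := by
  induction m generalizing a F with
  | zero =>
    simp [pathSum, Fin.sum_univ_two]
    ring
  | succ m ih =>
    change ∑ x, bitWeight p x * pathSum p (m + 1) x 1 (fun s => F (a * x + s))
        - ∑ x, bitWeight p x * pathSum p (m + 1) x 0 (fun s => F (a * x + s))
      = p * ∑ x, bitWeight p x * pathSum p m x 1 (fun s => F (a * x + (s + 1)) - F (a * x + s))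
    rw [← Finset.sum_sub_distrib, Finset.mul_sum]
    refine Finset.sum_congr rfl fun x _ => ?_
    rw [← mul_sub, ih, mul_left_comm]

/-! ### Exponential moments of paths and the cost of conditioning. -/

section
variable {p z : ℝ}

lemma pow_diff_eq (z : ℝ) : (fun s : ℕ => z ^ (s + 1) - z ^ s) = fun s => (z - 1) * z ^ s := by
  funext s; ring

lemma one_le_pathSum_pow (h0 : 0 ≤ p) (h1 : p ≤ 1) (hz : 1 ≤ z) (m : ℕ) (a b : Fin 2) :
    1 ≤ pathSum p m a b (z ^ ·) := by
  have h : ∀ m a b, pathSum p m a b (fun _ => 1) = 1 := by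
    intro m
    induction m with
    | zero => intro a b; rfl
    | succ m ih => intro a b; simp [pathSum, ih]
  rw [← h m a b]
  exact pathSum_mono h0 h1 m a b fun s => one_le_pow₀ hz

lemma pathSum_pow_le_succ (h0 : 0 ≤ p) (h1 : p ≤ 1) (hz : 1 ≤ z) (m : ℕ) (a b : Fin 2) :
    pathSum p m 0 b (z ^ ·) ≤ pathSum p (m + 1) a b (z ^ ·) := by
  have h : ∑ x, bitWeight p x * pathSum p m 0 b (z ^ ·) ≤ pathSum p (m + 1) a b (z ^ ·) := by
    refine Finset.sum_le_sum fun x _ =>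
      mul_le_mul_of_nonneg_left ?_ (bitWeight_nonneg h0 h1 x)
    refine (pathSum_mono_ends h0 h1 m (Fin.zero_le x) le_rfl (pow_right_mono₀ hz)).trans ?_
    exact pathSum_mono h0 h1 m x b fun s => pow_le_pow_right₀ hz (by omega)
  simpa [Fin.sum_univ_two, ← add_mul] using h

/-- With `u = p (z - 1)`, flipping the end costs `u` times the same quantity on a path one bit
shorter. Iterating gives a geometric series of ratio at most `1 / 2`, hence the factor `2`; the
remainder comes from the empty path, whose moment can be `z`. -/
lemma pathSum_pow_left_le (h0 : 0 ≤ p) (h1 : p ≤ 1) (hz : 1 ≤ z) (hpz : p * (z - 1) ≤ 1 / 2)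
    (m : ℕ) (b : Fin 2) :
    pathSum p m 1 b (z ^ ·) ≤ 2 * pathSum p m 0 b (z ^ ·) + (p * (z - 1)) ^ m * z := by
  have hu : 0 ≤ p * (z - 1) := mul_nonneg h0 (by linarith)
  induction m with
  | zero =>
    fin_cases b
    · simp only [pathSum]; norm_num; linarith
    · simp [pathSum]
  | succ m ih =>
    have e := pathSum_left_sub p m b (z ^ ·)
    rw [pow_diff_eq, pathSum_const_mul] at e
    have h2 := pathSum_pow_le_succ h0 h1 hz m 0 b
    have h3 := one_le_pathSum_pow h0 h1 hz m 0 b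
    have h4 := mul_le_mul_of_nonneg_left ih hu
    have h5 := mul_le_mul_of_nonneg_right hpz (by linarith : 0 ≤ pathSum p m 0 b (z ^ ·))
    have h6 : p * (z - 1) * ((p * (z - 1)) ^ m * z) = (p * (z - 1)) ^ (m + 1) * z := by ring
    nlinarith

lemma pathSum_pow_right_le (h0 : 0 ≤ p) (h1 : p ≤ 1) (hz : 1 ≤ z) (hpz : p * (z - 1) ≤ 1 / 2)
    (m : ℕ) : pathSum p m 0 1 (z ^ ·) ≤ 2 * pathSum p m 0 0 (z ^ ·) := by
  have hu : 0 ≤ p * (z - 1) := mul_nonneg h0 (by linarith)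
  induction m with
  | zero => simp [pathSum]
  | succ m ih =>
    have e := pathSum_right_sub p m 0 (z ^ ·)
    rw [pow_diff_eq, pathSum_const_mul] at e
    have h2 := pathSum_pow_le_succ h0 h1 hz m 0 0
    have h3 := one_le_pathSum_pow h0 h1 hz m 0 0
    have h4 := mul_le_mul_of_nonneg_left ih hu
    have h5 := mul_le_mul_of_nonneg_right hpz (by linarith : 0 ≤ pathSum p m 0 0 (z ^ ·))
    nlinarith

lemma pathSum_pow_le (h0 : 0 ≤ p) (h1 : p ≤ 1) (hz : 1 ≤ z) (hpz : p * (z - 1) ≤ 1 / 2)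
    (m : ℕ) (hm : (p * (z - 1)) ^ m * z ≤ 1) :
    pathSum p m 1 1 (z ^ ·) ≤ 6 * pathSum p m 0 0 (z ^ ·) := by
  have a := pathSum_pow_left_le h0 h1 hz hpz m 1
  have b := pathSum_pow_right_le h0 h1 hz hpz m
  have c := one_le_pathSum_pow h0 h1 hz m 0 1
  linarith

lemma pathSum_le_cycleMean_pow (h0 : 0 ≤ p) (h1 : p ≤ 1) (hz : 1 ≤ z) (m : ℕ) :
    pathSum p m 0 0 (z ^ ·) ≤ cycleMean p (m + 2) (z ^ ·) := by
  have h : ∑ a, ∑ b, bitWeight p a * bitWeight p b * pathSum p m 0 0 (z ^ ·)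
      ≤ cycleMean p (m + 2) (z ^ ·) := by
    rw [cycleMean_eq_pathSum]
    refine Finset.sum_le_sum fun a _ => Finset.sum_le_sum fun b _ =>
      mul_le_mul_of_nonneg_left ?_
        (mul_nonneg (bitWeight_nonneg h0 h1 a) (bitWeight_nonneg h0 h1 b))
    refine (pathSum_mono_ends h0 h1 m (Fin.zero_le a) (Fin.zero_le b)
      (pow_right_mono₀ hz)).trans ?_
    exact pathSum_mono h0 h1 m a b fun s => pow_le_pow_right₀ hz (by omega)
  convert h using 1
  simp [Fin.sum_univ_two]
  ring

lemma abs_pathSum_sub_cycleMean_le (h0 : 0 ≤ p) (h1 : p ≤ 1) (hz : 1 ≤ z) (hpz : p * z ≤ 1 / 2)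
    (m : ℕ) (hm : (p * (z - 1)) ^ m * z ≤ 1) {F : ℕ → ℝ} {B : ℝ}
    (hF : ∀ s, |F (s + 1) - F s| ≤ B * z ^ s) :
    |pathSum p (m + 1) 1 1 F - cycleMean p (m + 3) F|
      ≤ 24 * p * B * cycleMean p (m + 3) (z ^ ·) := by
  have hB : 0 ≤ B := by simpa using (abs_nonneg _).trans (hF 0)
  set Z := pathSum p m 1 1 (z ^ ·) with hZ
  have hZ1 : 1 ≤ Z := one_le_pathSum_pow h0 h1 hz m 1 1
  have hdiff : ∀ m a b, |pathSum p m a b (fun s => F (s + 1) - F s)|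
      ≤ B * pathSum p m a b (z ^ ·) := fun m a b => by
    rw [← pathSum_const_mul]
    exact abs_pathSum_le h0 h1 m a b hF
  have hmono : ∀ a b, pathSum p m a b (z ^ ·) ≤ Z := fun a b =>
    pathSum_mono_ends h0 h1 m (Fin.le_last a) (Fin.le_last b) (pow_right_mono₀ hz)
  have hstep : pathSum p (m + 1) 1 1 (z ^ ·) ≤ 2 * Z := by
    have e := pathSum_left_sub p m 1 (z ^ ·)
    rw [pow_diff_eq, pathSum_const_mul, ← hZ] at e
    have e2 : pathSum p (m + 1) 0 1 (z ^ ·) ≤ Z := by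
      have : pathSum p (m + 1) 0 1 (z ^ ·)
          = (1 - p) * pathSum p m 0 1 (z ^ ·) + p * Z := by
        simp [pathSum, Fin.sum_univ_two, hZ]
      rw [this]
      nlinarith [hmono 0 1]
    nlinarith
  have hL : ∀ b, |pathSum p (m + 1) 1 b F - pathSum p (m + 1) 0 b F| ≤ p * (B * Z) := fun b => by
    rw [pathSum_left_sub, abs_mul, abs_of_nonneg h0]
    gcongr
    exact (hdiff m 1 b).trans (by gcongr; exact hmono 1 b)
  have hR : |pathSum p (m + 1) 1 1 F - pathSum p (m + 1) 1 0 F| ≤ p * (B * Z) := by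
    rw [pathSum_right_sub, abs_mul, abs_of_nonneg h0]
    gcongr
    exact hdiff m 1 1
  have hS : |pathSum p (m + 1) 1 1 (fun s => F (s + 1)) - pathSum p (m + 1) 1 1 F|
      ≤ 2 * (B * Z) := by
    rw [← pathSum_sub]
    exact (hdiff (m + 1) 1 1).trans (by nlinarith)
  -- The cyclic mean mixes the four values of the end pair. Flipping one end costs `p B Z`, and the
  -- wrap-around run costs `2 B Z` with weight `p² ≤ p`; with `q = 1 - p` the total is at most `2 q²
  -- + 2 p q + 2 ≤ 4` times `p B Z`.
  have key : |pathSum p (m + 1) 1 1 F - cycleMean p (m + 3) F| ≤ 4 * p * (B * Z) := by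
    rw [cycleMean_eq_pathSum p (m + 1)]
    simp only [Fin.sum_univ_two, bitWeight_zero, bitWeight_one, Fin.val_zero, Fin.val_one,
      mul_zero, mul_one, zero_mul, add_zero]
    set A := pathSum p (m + 1) 1 1 F
    set A' := pathSum p (m + 1) 1 1 (fun s => F (s + 1))
    have hL0 := abs_le.1 (hL 0)
    have hL1 := abs_le.1 (hL 1)
    have hR := abs_le.1 hR
    have hS := abs_le.1 hS
    have hq : 0 ≤ 1 - p := by linarith
    have hq2 := mul_nonneg hq hq
    have hpq := mul_nonneg h0 hq
    have hpp := mul_nonneg h0 h0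
    have hBZ : 0 ≤ B * Z := by positivity
    have hp2 : p * p ≤ p := by nlinarith
    have b1 : 0 ≤ p * (B * Z) := by positivity
    have b2 : p * p * (B * Z) ≤ p * (B * Z) := by gcongr
    have e : A - ((1 - p) * (1 - p) * pathSum p (m + 1) 0 0 F
          + (1 - p) * p * pathSum p (m + 1) 0 1 F
          + (p * (1 - p) * pathSum p (m + 1) 1 0 F + p * p * A'))
        = (1 - p) * (1 - p) * ((A - pathSum p (m + 1) 1 0 F)
            + (pathSum p (m + 1) 1 0 F - pathSum p (m + 1) 0 0 F))
          + p * (1 - p) * ((A - pathSum p (m + 1) 0 1 F) + (A - pathSum p (m + 1) 1 0 F))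
          - p * p * (A' - A) := by ring
    rw [e, abs_le]
    have c1 : (1 - p) * (1 - p) + p * (1 - p) ≤ 1 := by nlinarith
    have c2 := mul_le_mul_of_nonneg_right c1 b1
    constructor
    · nlinarith [mul_le_mul_of_nonneg_left (add_le_add hR.1 hL0.1) hq2,
        mul_le_mul_of_nonneg_left (add_le_add hL1.1 hR.1) hpq,
        mul_le_mul_of_nonneg_left hS.2 hpp]
    · nlinarith [mul_le_mul_of_nonneg_left (add_le_add hR.2 hL0.2) hq2,
        mul_le_mul_of_nonneg_left (add_le_add hL1.2 hR.2) hpq,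
        mul_le_mul_of_nonneg_left hS.1 hpp]
  refine key.trans ?_
  have hZG : Z ≤ 6 * cycleMean p (m + 3) (z ^ ·) := by
    have a1 := pathSum_pow_le h0 h1 hz (by nlinarith) m hm
    have a2 := pathSum_pow_le_succ h0 h1 hz m 0 0
    have a3 := pathSum_le_cycleMean_pow h0 h1 hz (m + 1)
    linarith
  calc 4 * p * (B * Z) ≤ 4 * p * (B * (6 * cycleMean p (m + 3) (z ^ ·))) := by gcongr
    _ = _ := by ring

end

/-! ### The Stein operator under the tilted law. -/

lemma cycleMean_const_mul (p c : ℝ) (n : ℕ) (F : ℕ → ℝ) :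
    cycleMean p n (fun s => c * F s) = c * cycleMean p n F := by
  simp only [cycleMean, Finset.mul_sum]
  exact Finset.sum_congr rfl fun _ _ => by ring

lemma cycleMean_sub (p : ℝ) (n : ℕ) (F H : ℕ → ℝ) :
    cycleMean p n (fun s => F s - H s) = cycleMean p n F - cycleMean p n H := by
  simp only [cycleMean, mul_sub, Finset.sum_sub_distrib]

/-- The Stein operator of the Poisson law, applied under the law of the number of runs tilted by
`z ^ W`. -/
lemma abs_cycleMean_stein_le {p z : ℝ} (h0 : 0 ≤ p) (h1 : p ≤ 1) (hz : 1 ≤ z)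
    (hpz : p * z ≤ 1 / 2) (m : ℕ) (hm : (p * (z - 1)) ^ m * z ≤ 1) {f : ℕ → ℝ} {B : ℝ}
    (hf : ∀ s, |z * f (s + 2) - f (s + 1)| ≤ B) :
    |cycleMean p (m + 3)
        (fun s => z ^ s * ((m + 3) * p ^ 2 * z * f (s + 1) - s * f s))|
      ≤ 24 * p * ((m + 3) * p ^ 2 * z) * B * cycleMean p (m + 3) (z ^ ·) := by
  have h := abs_pathSum_sub_cycleMean_le h0 h1 hz hpz m hm (F := fun s => z ^ (s + 1) * f (s + 1))
    (B := z * B) fun s => by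
      have : z ^ (s + 1 + 1) * f (s + 1 + 1) - z ^ (s + 1) * f (s + 1)
          = z ^ (s + 1) * (z * f (s + 2) - f (s + 1)) := by ring
      rw [this, abs_mul, abs_of_nonneg (by positivity)]
      calc _ ≤ z ^ (s + 1) * B := by gcongr; exact hf s
        _ = _ := by ring
  have e1 := cycleMean_mul_self p (m + 1) (fun s => z ^ s * f s)
  have e2 : cycleMean p (m + 3) (fun s => z ^ s * ((m + 3) * p ^ 2 * z * f (s + 1) - s * f s))
      = -(((m + 3) * p ^ 2) * (pathSum p (m + 1) 1 1 (fun s => z ^ (s + 1) * f (s + 1))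
          - cycleMean p (m + 3) (fun s => z ^ (s + 1) * f (s + 1)))) := by
    rw [mul_sub, ← cycleMean_const_mul]
    push_cast at e1
    rw [show ((m : ℝ) + 3) = m + 1 + 2 by ring, ← e1, ← cycleMean_sub, ← neg_one_mul,
      ← cycleMean_const_mul]
    congr 1
    funext s
    ring
  rw [e2, abs_neg, abs_mul, abs_of_nonneg (by positivity)]
  calc _ ≤ ((m + 3) * p ^ 2) * (24 * p * (z * B) * cycleMean p (m + 3) (z ^ ·)) := by gcongr
    _ = _ := by ring

/-! ### The generating function of the number of runs -/

lemma cycleMean_pow_pos {p z : ℝ} (h0 : 0 ≤ p) (h1 : p ≤ 1) (hz : 1 ≤ z) (m : ℕ) :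
    0 < cycleMean p (m + 2) (z ^ ·) := by
  linarith [one_le_pathSum_pow h0 h1 hz m 0 0, pathSum_le_cycleMean_pow h0 h1 hz m]

lemma sum_wordWeight (p : ℝ) (n : ℕ) : ∑ x : Fin n → Fin 2, wordWeight p x = 1 := by
  induction n with
  | zero => simp [wordWeight]
  | succ n ih =>
    rw [sum_cons]
    simp [wordWeight_cons, ← Finset.mul_sum, ih, Fin.sum_univ_two]

lemma hasDerivAt_cycleMean_pow (p z : ℝ) (m : ℕ) :
    HasDerivAt (fun t => cycleMean p (m + 2) (t ^ ·))
      ((m + 2) * p ^ 2 * pathSum p m 1 1 (z ^ ·)) z := by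
  -- The truncated exponent at `s = 0` is harmless because of the factor `s`.
  have h := cycleMean_mul_self p m (fun s => z ^ (s - 1))
  simp only [Nat.add_sub_cancel] at h
  rw [← h]
  exact HasDerivAt.fun_sum fun x _ => (hasDerivAt_pow _ z).const_mul _

/-- The logarithmic derivative of the generating function is within `24 p l (t - 1)` of `l`, by the
conditioning bound for `t ^ s`; integrating from `1` to `z` gives the constant `12`. The sign `σ`
treats both inequalities at once. -/
lemma abs_log_cycleMean_pow_sub_le {p z : ℝ} (h0 : 0 ≤ p) (h1 : p ≤ 1) (hz : 1 ≤ z)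
    (hpz : p * z ≤ 1 / 2) (m : ℕ) (hm : (p * (z - 1)) ^ m * z ≤ 1) :
    |Real.log (cycleMean p (m + 3) (z ^ ·)) - (m + 3) * p ^ 2 * (z - 1)|
      ≤ 12 * p * ((m + 3) * p ^ 2) * (z - 1) ^ 2 := by
  set l : ℝ := (m + 3) * p ^ 2 with hl
  have hl0 : 0 ≤ l := by positivity
  have hG1 : Real.log (cycleMean p (m + 3) fun _ => 1) = 0 := by
    simp [cycleMean, sum_wordWeight]
  have hder : ∀ (σ t : ℝ), 1 ≤ t →
      HasDerivAt (fun t => σ * (Real.log (cycleMean p (m + 3) (t ^ ·)) - l * (t - 1))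
          - 12 * p * l * (t - 1) ^ 2)
        (σ * (l * pathSum p (m + 1) 1 1 (t ^ ·) / cycleMean p (m + 3) (t ^ ·) - l)
          - 24 * p * l * (t - 1)) t := by
    intro σ t ht
    have a := hasDerivAt_cycleMean_pow p t (m + 1)
    have b := (a.log (cycleMean_pow_pos h0 h1 ht (m + 1)).ne').sub
      (((hasDerivAt_id t).sub_const 1).const_mul l)
    have c := (b.const_mul σ).sub
      ((((hasDerivAt_id t).sub_const 1).pow 2).const_mul (12 * p * l))
    refine c.congr_deriv ?_
    push_cast
    simp only [id]
    rw [hl]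
    ring
  have hneg : ∀ σ : ℝ, |σ| = 1 →
      σ * (Real.log (cycleMean p (m + 3) (z ^ ·)) - l * (z - 1)) - 12 * p * l * (z - 1) ^ 2 ≤ 0 := by
    intro σ hσ
    have anti : AntitoneOn (fun t => σ * (Real.log (cycleMean p (m + 3) (t ^ ·)) - l * (t - 1))
          - 12 * p * l * (t - 1) ^ 2) (Set.Icc 1 z) := by
      refine antitoneOn_of_deriv_nonpos (convex_Icc 1 z)
        (fun t ht => (hder σ t ht.1).continuousAt.continuousWithinAt) ?_ ?_
      · intro t ht
        rw [interior_Icc] at ht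
        exact (hder σ t ht.1.le).differentiableAt.differentiableWithinAt
      · intro t ht
        rw [interior_Icc] at ht
        rw [(hder σ t ht.1.le).deriv]
        have ht1 : 1 ≤ t := ht.1.le
        have htz : t ≤ z := ht.2.le
        have hu : 0 ≤ p * (t - 1) := mul_nonneg h0 (by linarith)
        have hG := cycleMean_pow_pos h0 h1 ht1 (m + 1)
        have key := abs_pathSum_sub_cycleMean_le h0 h1 ht1
          ((mul_le_mul_of_nonneg_left htz h0).trans hpz) m
          (le_trans (by gcongr) hm) (F := (t ^ ·)) (B := t - 1) fun s => by
            rw [congrFun (pow_diff_eq t) s, abs_of_nonneg (by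
              exact mul_nonneg (by linarith) (by positivity))]
        set G := cycleMean p (m + 3) (t ^ ·)
        set Q := pathSum p (m + 1) 1 1 (t ^ ·)
        have e : l * Q / G - l = l * ((Q - G) / G) := by
          field_simp
        have k2 : |(Q - G) / G| ≤ 24 * p * (t - 1) := by
          rw [abs_div, abs_of_pos hG, div_le_iff₀ hG]
          exact key
        have k3 : σ * (l * ((Q - G) / G)) ≤ l * (24 * p * (t - 1)) := by
          refine (le_abs_self _).trans ?_
          rw [abs_mul, hσ, one_mul, abs_mul, abs_of_nonneg hl0]
          gcongr
        rw [e]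
        linarith
    have := anti (Set.left_mem_Icc.2 hz) (Set.right_mem_Icc.2 hz) hz
    simpa [hG1] using this
  have p1 := hneg 1 (by simp)
  have p2 := hneg (-1) (by simp)
  rw [abs_le]
  constructor <;> linarith

/-! ### The Stein equation of the Poisson law -/

open scoped Nat in
/-- The mass of the Poisson law of mean `r` at `j`. -/
noncomputable def poissonWeight (r : ℝ) (j : ℕ) : ℝ := Real.exp (-r) * r ^ j / j !

/-- The Poisson mass of `{j | j < i}`. -/
noncomputable def poissonHead (r : ℝ) (i : ℕ) : ℝ := ∑ j ∈ Finset.range i, poissonWeight r j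

/-- The Poisson mass of `{j | i ≤ j}`. -/
noncomputable def poissonTail (r : ℝ) (i : ℕ) : ℝ := ∑' j, poissonWeight r (j + i)

lemma poissonWeight_pos {r : ℝ} (hr : 0 < r) (j : ℕ) : 0 < poissonWeight r j := by
  unfold poissonWeight; positivity

lemma succ_mul_poissonWeight_succ (r : ℝ) (j : ℕ) :
    (j + 1) * poissonWeight r (j + 1) = r * poissonWeight r j := by
  unfold poissonWeight
  rw [Nat.factorial_succ]
  push_cast
  have : (j.factorial : ℝ) ≠ 0 := by positivity
  field_simp
  ring

lemma hasSum_poissonWeight {r : ℝ} (hr : 0 ≤ r) : HasSum (poissonWeight r) 1 :=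
  hasSum_one_poissonMeasure ⟨r, hr⟩

lemma summable_poissonWeight_add {r : ℝ} (hr : 0 ≤ r) (i : ℕ) :
    Summable fun j => poissonWeight r (j + i) :=
  (summable_nat_add_iff i).2 (hasSum_poissonWeight hr).summable

lemma poissonHead_add_tail {r : ℝ} (hr : 0 ≤ r) (i : ℕ) : poissonHead r i + poissonTail r i = 1 :=
  ((hasSum_poissonWeight hr).summable.sum_add_tsum_nat_add i).trans
    (hasSum_poissonWeight hr).tsum_eq

lemma poissonHead_succ (r : ℝ) (i : ℕ) :
    poissonHead r (i + 1) = poissonHead r i + poissonWeight r i := Finset.sum_range_succ _ _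

lemma poissonTail_eq_add {r : ℝ} (hr : 0 ≤ r) (i : ℕ) :
    poissonTail r i = poissonWeight r i + poissonTail r (i + 1) := by
  linarith [poissonHead_add_tail hr i, poissonHead_add_tail hr (i + 1), poissonHead_succ r i]

lemma poissonHead_nonneg {r : ℝ} (hr : 0 < r) (i : ℕ) : 0 ≤ poissonHead r i :=
  Finset.sum_nonneg fun _ _ => (poissonWeight_pos hr _).le

lemma poissonTail_nonneg {r : ℝ} (hr : 0 < r) (i : ℕ) : 0 ≤ poissonTail r i :=
  tsum_nonneg fun _ => (poissonWeight_pos hr _).le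

lemma mul_poissonHead_le {r : ℝ} (hr : 0 < r) (i : ℕ) :
    r * poissonHead r i ≤ i * poissonHead r (i + 1) := by
  have : r * poissonHead r i = ∑ j ∈ Finset.range (i + 1), j * poissonWeight r j := by
    rw [Finset.sum_range_succ', poissonHead, Finset.mul_sum]
    simp [succ_mul_poissonWeight_succ]
  rw [this, poissonHead, Finset.mul_sum]
  refine Finset.sum_le_sum fun j hj => ?_
  have : (j : ℝ) ≤ i := by exact_mod_cast Nat.lt_succ_iff.1 (Finset.mem_range.1 hj)
  exact mul_le_mul_of_nonneg_right this (poissonWeight_pos hr j).le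

lemma succ_mul_poissonTail_le {r : ℝ} (hr : 0 < r) (i : ℕ) :
    (i + 1) * poissonTail r (i + 1) ≤ r * poissonTail r i := by
  rw [poissonTail, poissonTail, ← tsum_mul_left, ← tsum_mul_left]
  refine Summable.tsum_le_tsum (fun j => ?_) ((summable_poissonWeight_add hr.le _).mul_left _)
    ((summable_poissonWeight_add hr.le _).mul_left _)
  rw [← succ_mul_poissonWeight_succ, ← add_assoc]
  refine mul_le_mul_of_nonneg_right ?_ (poissonWeight_pos hr _).le
  push_cast
  linarith [(Nat.cast_nonneg j : (0 : ℝ) ≤ j)]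

/-- At distance `t` below the mean, `mul_poissonHead_le` already bounds the head by `r / t` times
its last mass. Each of the `d` further steps towards the mean adds one mass, and the masses increase
up to `r`. -/
lemma poissonHead_succ_le_of_le {r t : ℝ} (hr : 0 < r) (ht : 0 < t) (d i : ℕ) (hi : i ≤ r)
    (hd : i ≤ r - t + d) : poissonHead r (i + 1) ≤ (r / t + 1 + d) * poissonWeight r i := by
  have hw := poissonWeight_pos hr
  induction d generalizing i with
  | zero =>
    have h := mul_poissonHead_le hr i
    have h2 := poissonHead_succ r i
    have h3 : t * poissonHead r (i + 1) ≤ r * poissonWeight r i := by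
      have h4 : t * poissonHead r (i + 1) ≤ (r - i) * poissonHead r (i + 1) := by
        refine mul_le_mul_of_nonneg_right ?_ (poissonHead_nonneg hr _)
        simp at hd; linarith
      nlinarith
    have h5 : poissonHead r (i + 1) ≤ r / t * poissonWeight r i := by
      rw [div_mul_eq_mul_div, le_div_iff₀ ht]; linarith
    have := hw i
    push_cast
    linarith
  | succ d ih =>
    have ht' : 0 < r / t := by positivity
    cases i with
    | zero =>
      have := hw 0
      rw [poissonHead_succ]
      simp only [poissonHead, Finset.range_zero, Finset.sum_empty, zero_add]
      exact le_mul_of_one_le_left this.le (by push_cast; linarith [(Nat.cast_nonneg d : (0 : ℝ) ≤ d)])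
    | succ i =>
      push_cast at hi hd ⊢
      have h := ih i (by linarith) (by linarith)
      rw [poissonHead_succ]
      have h2 : poissonWeight r i ≤ poissonWeight r (i + 1) := by
        have e := succ_mul_poissonWeight_succ r i
        have : (i + 1) * poissonWeight r (i + 1) ≤ r * poissonWeight r (i + 1) :=
          mul_le_mul_of_nonneg_right hi (hw _).le
        exact le_of_mul_le_mul_left (by linarith) hr
      have h3 := mul_le_mul_of_nonneg_left h2 (by positivity : 0 ≤ r / t + 1 + d)
      linarith

lemma poissonTail_succ_le_of_le {r t : ℝ} (hr : 0 < r) (ht : 0 < t) (d i : ℕ) (hi : r ≤ i)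
    (hd : r + t ≤ i + 1 + d) : poissonTail r (i + 1) ≤ (r / t + d) * poissonWeight r i := by
  have hw := poissonWeight_pos hr
  induction d generalizing i with
  | zero =>
    have h := succ_mul_poissonTail_le hr i
    have h2 := poissonTail_eq_add hr.le i
    have h4 : t * poissonTail r (i + 1) ≤ (i + 1 - r) * poissonTail r (i + 1) := by
      refine mul_le_mul_of_nonneg_right ?_ (poissonTail_nonneg hr _)
      simp at hd; linarith
    simp only [Nat.cast_zero, add_zero]
    rw [div_mul_eq_mul_div, le_div_iff₀ ht]
    nlinarith
  | succ d ih =>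
    push_cast at hd ⊢
    have h := ih (i + 1) (by push_cast; linarith) (by push_cast; linarith)
    rw [poissonTail_eq_add hr.le]
    have h2 : poissonWeight r (i + 1) ≤ poissonWeight r i := by
      have e := succ_mul_poissonWeight_succ r i
      have : r * poissonWeight r (i + 1) ≤ (i + 1) * poissonWeight r (i + 1) :=
        mul_le_mul_of_nonneg_right (by linarith) (hw _).le
      exact le_of_mul_le_mul_left (by linarith) hr
    have h3 := mul_le_mul_of_nonneg_left h2 (by positivity : 0 ≤ r / t + 1 + d)
    linarith

/-- On each side of the mean, bound the factor on the far side by `1` and the other one with `t =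
√r`, `d = ⌈√r⌉`. -/
lemma poissonHead_mul_tail_le {r : ℝ} (hr : 1 ≤ r) (i : ℕ) :
    poissonHead r (i + 1) * poissonTail r (i + 1) ≤ 4 * √r * poissonWeight r i := by
  have hr0 : 0 < r := by linarith
  have ht : 1 ≤ √r := Real.one_le_sqrt.2 hr
  have hd1 := Nat.le_ceil (√r)
  have hd2 := Nat.ceil_lt_add_one (zero_le_one.trans ht)
  have hw := poissonWeight_pos hr0 i
  have hP := poissonHead_nonneg hr0 (i + 1)
  have hQ := poissonTail_nonneg hr0 (i + 1)
  have hPQ := poissonHead_add_tail hr0.le (i + 1)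
  have hdiv : r / √r = √r := Real.div_sqrt
  rcases le_total (i : ℝ) r with hi | hi
  · have h := poissonHead_succ_le_of_le hr0 (by linarith) ⌈√r⌉₊ i hi (by linarith)
    rw [hdiv] at h
    calc _ ≤ poissonHead r (i + 1) * 1 := by gcongr; linarith
      _ ≤ _ := by rw [mul_one]; exact h.trans (by gcongr; linarith)
  · have h := poissonTail_succ_le_of_le hr0 (by linarith) ⌈√r⌉₊ i hi (by linarith)
    rw [hdiv] at h
    calc _ ≤ 1 * poissonTail r (i + 1) := by gcongr; linarith
      _ ≤ _ := by rw [one_mul]; exact h.trans (by gcongr; linarith)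

/-- The Stein equation of the Poisson law has a solution with the usual bounds. -/
theorem exists_poisson_stein_solution {r : ℝ} (hr : 1 ≤ r) {h : ℕ → ℝ} (h0 : ∀ j, 0 ≤ h j)
    (h1 : ∀ j, h j ≤ 1) :
    ∃ f : ℕ → ℝ, (∀ i, r * f (i + 1) - i * f i = h i - ∑' j, poissonWeight r j * h j) ∧
      (∀ i, |f (i + 1)| ≤ 4 / √r) ∧ ∀ i, |f (i + 2) - f (i + 1)| ≤ 1 / r := by
  have hr0 : 0 < r := by linarith
  have hw := poissonWeight_pos hr0
  have hsum : Summable fun j => poissonWeight r j * h j :=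
    Summable.of_nonneg_of_le (fun j => mul_nonneg (hw j).le (h0 j))
      (fun j => mul_le_of_le_one_right (hw j).le (h1 j)) (hasSum_poissonWeight hr0.le).summable
  set E := ∑' j, poissonWeight r j * h j with hE
  let S : ℕ → ℝ := fun i => ∑ j ∈ Finset.range i, poissonWeight r j * h j
  let T : ℕ → ℝ := fun i => ∑' j, poissonWeight r (j + i) * h (j + i)
  have hST : ∀ i, S i + T i = E := fun i => hsum.sum_add_tsum_nat_add i
  have hSs : ∀ i, S (i + 1) = S i + poissonWeight r i * h i := fun i => Finset.sum_range_succ _ _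
  have hTs : ∀ i, T i = poissonWeight r i * h i + T (i + 1) := fun i => by
    linarith [hST i, hST (i + 1), hSs i]
  have hS0 : ∀ i, 0 ≤ S i := fun i => Finset.sum_nonneg fun j _ => mul_nonneg (hw j).le (h0 j)
  have hSP : ∀ i, S i ≤ poissonHead r i := fun i =>
    Finset.sum_le_sum fun j _ => mul_le_of_le_one_right (hw j).le (h1 j)
  have hT0 : ∀ i, 0 ≤ T i := fun i => tsum_nonneg fun j => mul_nonneg (hw _).le (h0 _)
  have hTQ : ∀ i, T i ≤ poissonTail r i := fun i =>
    Summable.tsum_le_tsum (fun j => mul_le_of_le_one_right (hw _).le (h1 _))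
      ((summable_nat_add_iff i).2 hsum) (summable_poissonWeight_add hr0.le i)
  have hPQ := poissonHead_add_tail hr0.le
  have hP0 := poissonHead_nonneg hr0
  have hQ0 := poissonTail_nonneg hr0
  let N : ℕ → ℝ := fun i => S i - poissonHead r i * E
  have hN : ∀ i, N i = S i * poissonTail r i - poissonHead r i * T i := fun i => by
    simp only [N]
    rw [← hST i]
    linear_combination (-S i) * hPQ i
  -- Division by zero gives `f 0 = 0`; this value never matters, since the Stein equation multiplies
  -- it by `0`.
  let f : ℕ → ℝ := fun i => N i / (i * poissonWeight r i)
  have hf : ∀ i, f (i + 1) = N (i + 1) / (r * poissonWeight r i) := fun i => by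
    simp only [f]
    push_cast
    rw [succ_mul_poissonWeight_succ]
  refine ⟨f, fun i => ?_, fun i => ?_, fun i => ?_⟩
  · have hif : i * f i = N i / poissonWeight r i := by
      rcases Nat.eq_zero_or_pos i with rfl | hi
      · simp [N, S, poissonHead]
      · have : (i : ℝ) ≠ 0 := by positivity
        have := (hw i).ne'
        simp only [f]
        field_simp
    have hNs : N (i + 1) = N i + poissonWeight r i * (h i - E) := by
      simp only [N]
      rw [hSs, poissonHead_succ]
      ring
    rw [hif, hf, hNs]
    have := (hw i).ne'
    field_simp
    ring
  · rw [hf, abs_div, abs_of_pos (mul_pos hr0 (hw i)), div_le_iff₀ (mul_pos hr0 (hw i))]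
    have hb : |N (i + 1)| ≤ poissonHead r (i + 1) * poissonTail r (i + 1) := by
      rw [hN, abs_le]
      have a1 := mul_le_mul_of_nonneg_right (hSP (i + 1)) (hQ0 (i + 1))
      have a2 := mul_le_mul_of_nonneg_left (hTQ (i + 1)) (hP0 (i + 1))
      have a3 := mul_nonneg (hS0 (i + 1)) (hQ0 (i + 1))
      have a4 := mul_nonneg (hP0 (i + 1)) (hT0 (i + 1))
      constructor <;> linarith
    refine hb.trans ((poissonHead_mul_tail_le hr i).trans_eq ?_)
    have hs : 0 < √r := Real.sqrt_pos.2 hr0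
    field_simp
    rw [Real.sq_sqrt hr0.le]
    ring
  · have e : f (i + 2) - f (i + 1)
        = ((i + 1) * N (i + 2) - r * N (i + 1)) / (r * ((i + 1) * poissonWeight r (i + 1))) := by
      rw [hf (i + 1), hf i, succ_mul_poissonWeight_succ]
      have e1 : r * poissonWeight r (i + 1) = r * (r * poissonWeight r i) / (i + 1) := by
        rw [← succ_mul_poissonWeight_succ r i]
        field_simp
      rw [e1]
      have := (hw i).ne'
      field_simp
    have hw1 := hw (i + 1)
    have hpos : 0 < r * ((i + 1) * poissonWeight r (i + 1)) := by positivity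
    rw [e, abs_div, abs_of_pos hpos, div_le_iff₀ hpos, one_div, inv_mul_cancel_left₀ hr0.ne']
    have b1 := mul_poissonHead_le hr0 (i + 1)
    have b2 := succ_mul_poissonTail_le hr0 (i + 1)
    push_cast at b1 b2
    have c1 := poissonHead_succ r (i + 1)
    have c2 := poissonTail_eq_add hr0.le (i + 1)
    have c3 := hPQ (i + 2)
    rw [hN, hN, hSs (i + 1), hTs (i + 1)]
    set w := poissonWeight r (i + 1)
    set P := poissonHead r (i + 1)
    set P' := poissonHead r (i + 1 + 1)
    set Q := poissonTail r (i + 1)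
    set Q' := poissonTail r (i + 1 + 1)
    have d1 : (i + 1) * Q' ≤ r * Q := by
      have : 0 ≤ Q' := hQ0 _
      linarith
    have d2 : 0 ≤ (r * Q - (i + 1) * Q') * S (i + 1) :=
      mul_nonneg (by linarith) (hS0 _)
    have d3 : (r * Q - (i + 1) * Q') * S (i + 1) ≤ (r * Q - (i + 1) * Q') * P :=
      mul_le_mul_of_nonneg_left (hSP _) (by linarith)
    have d4 : 0 ≤ ((i + 1) * P' - r * P) * T (i + 1 + 1) := mul_nonneg (by linarith) (hT0 _)
    have d5 : ((i + 1) * P' - r * P) * T (i + 1 + 1) ≤ ((i + 1) * P' - r * P) * Q' :=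
      mul_le_mul_of_nonneg_left (hTQ _) (by linarith)
    have d6 : 0 ≤ w * ((i + 1) * Q' + r * P) :=
      mul_nonneg hw1.le (add_nonneg (mul_nonneg (by positivity) (hQ0 _))
        (mul_nonneg hr0.le (hP0 _)))
    have d7 : w * ((i + 1) * Q' + r * P) * h (i + 1) ≤ w * ((i + 1) * Q' + r * P) :=
      mul_le_of_le_one_right d6 (h1 _)
    have d8 : 0 ≤ w * ((i + 1) * Q' + r * P) * h (i + 1) := mul_nonneg d6 (h0 _)
    have d9 : w * ((i + 1) * Q' + r * P) ≤ w * (i + 1) := by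
      refine mul_le_mul_of_nonneg_left ?_ hw1.le
      calc _ ≤ (i + 1) * Q' + (i + 1) * P' := by linarith
        _ = (i + 1) * (P' + Q') := by ring
        _ = _ := by rw [c3, mul_one]
    -- The increment is a nonnegative term carrying `h (i + 1)` minus two nonnegative terms carrying
    -- the other values of `h`. By `sumEq` both groups have the same maximum over `0 ≤ h ≤ 1`, so
    -- there is no loss in bounding the difference by that maximum.
    have ident : (i + 1) * ((S (i + 1) + w * h (i + 1)) * Q' - P' * T (i + 1 + 1))
          - r * (S (i + 1) * Q - P * (w * h (i + 1) + T (i + 1 + 1)))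
        = -((r * Q - (i + 1) * Q') * S (i + 1)) - ((i + 1) * P' - r * P) * T (i + 1 + 1)
          + w * ((i + 1) * Q' + r * P) * h (i + 1) := by ring
    have sumEq : (r * Q - (i + 1) * Q') * P + ((i + 1) * P' - r * P) * Q'
        = w * ((i + 1) * Q' + r * P) := by
      rw [c1, c2]; ring
    show |(i + 1) * ((S (i + 1) + w * h (i + 1)) * Q' - P' * T (i + 1 + 1))
          - r * (S (i + 1) * Q - P * (w * h (i + 1) + T (i + 1 + 1)))| ≤ _
    rw [ident, abs_le]
    constructor <;> linarith

/-! ### A lower bound for geometrically weighted Poisson tails -/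

/-- The weight `z ^ (k - j)` on `{j | k ≤ j}`, which undoes the exponential tilt. -/
noncomputable def tiltedTail (z : ℝ) (k j : ℕ) : ℝ := if k ≤ j then z⁻¹ ^ (j - k) else 0

lemma tiltedTail_nonneg {z : ℝ} (hz : 1 ≤ z) (k j : ℕ) : 0 ≤ tiltedTail z k j := by
  unfold tiltedTail; split_ifs <;> positivity

lemma tiltedTail_le_one {z : ℝ} (hz : 1 ≤ z) (k j : ℕ) : tiltedTail z k j ≤ 1 := by
  unfold tiltedTail
  split_ifs
  · exact pow_le_one₀ (by positivity) (inv_le_one_of_one_le₀ hz)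
  · exact zero_le_one

lemma pow_mul_tiltedTail {z : ℝ} (hz : z ≠ 0) (k j : ℕ) :
    z ^ j * tiltedTail z k j = z ^ k * if k ≤ j then 1 else 0 := by
  unfold tiltedTail
  split_ifs with h
  · obtain ⟨d, rfl⟩ := Nat.exists_eq_add_of_le h
    rw [Nat.add_sub_cancel_left, pow_add, mul_assoc, ← mul_pow, mul_inv_cancel₀ hz, one_pow]
  · simp

lemma factorial_le_exp_one_mul {k : ℕ} (hk : 1 ≤ k) :
    (k.factorial : ℝ) ≤ Real.exp 1 * √k * (k / Real.exp 1) ^ k := by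
  obtain ⟨i, rfl⟩ := Nat.exists_eq_add_of_le' hk
  have h : Stirling.stirlingSeq (i + 1) ≤ Stirling.stirlingSeq 1 :=
    Stirling.stirlingSeq'_antitone (Nat.zero_le i)
  rw [Stirling.stirlingSeq_one, Stirling.stirlingSeq, div_le_iff₀ (by positivity)] at h
  refine h.trans_eq ?_
  rw [Real.sqrt_mul (by norm_num)]
  have : √(2 : ℝ) ≠ 0 := by positivity
  field_simp

lemma poissonWeight_self_ge {k : ℕ} (hk : 1 ≤ k) :
    (Real.exp 1 * √k)⁻¹ ≤ poissonWeight k k := by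
  have hk0 : (0 : ℝ) < k := by exact_mod_cast hk
  unfold poissonWeight
  rw [inv_le_iff_one_le_mul₀ (by positivity), div_mul_eq_mul_div, le_div_iff₀ (by positivity), one_mul]
  refine (factorial_le_exp_one_mul hk).trans_eq ?_
  rw [div_pow, ← Real.exp_nat_mul, mul_one, Real.exp_neg]
  field_simp

/-- The ratio to the mass at `k` is `∏ k / (k + i) ≥ (1 + j / k) ^ (-j) ≥ exp (-j² / k) ≥ exp (-1)`;
Stirling handles the mass at `k`. -/
lemma poissonWeight_add_ge {k j : ℕ} (hk : 1 ≤ k) (hj : j * j ≤ k) :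
    (Real.exp 2 * √k)⁻¹ ≤ poissonWeight k (k + j) := by
  have hk0 : (0 : ℝ) < k := by exact_mod_cast hk
  have hw := poissonWeight_pos hk0
  have step : ∀ i ≤ j, (k : ℝ) ^ i * poissonWeight k k ≤ (k + j) ^ i * poissonWeight k (k + i) := by
    intro i
    induction i with
    | zero => simp
    | succ i ih =>
      intro hi
      have e := succ_mul_poissonWeight_succ k (k + i)
      have hij : (i : ℝ) + 1 ≤ j := by exact_mod_cast hi
      calc (k : ℝ) ^ (i + 1) * poissonWeight k k = k * (k ^ i * poissonWeight k k) := by ring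
        _ ≤ k * ((k + j) ^ i * poissonWeight k (k + i)) :=
          mul_le_mul_of_nonneg_left (ih (by omega)) hk0.le
        _ = (k + j) ^ i * (((k + i : ℕ) + 1) * poissonWeight k (k + i + 1)) := by rw [e]; ring
        _ ≤ (k + j) ^ i * ((k + j) * poissonWeight k (k + i + 1)) := by
          refine mul_le_mul_of_nonneg_left
            (mul_le_mul_of_nonneg_right ?_ (hw (k + i + 1)).le) (by positivity)
          push_cast
          linarith
        _ = _ := by rw [← add_assoc]; ring
  have hexp : ((k : ℝ) + j) ^ j ≤ k ^ j * Real.exp 1 := by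
    have h1 : (k : ℝ) + j = k * (j / k + 1) := by field_simp; ring
    rw [h1, mul_pow]
    gcongr
    calc ((j : ℝ) / k + 1) ^ j ≤ Real.exp (j / k) ^ j := by
          gcongr; exact Real.add_one_le_exp _
      _ = Real.exp (j * (j / k)) := (Real.exp_nat_mul _ _).symm
      _ ≤ Real.exp 1 := by
          rw [Real.exp_le_exp, mul_div_assoc', div_le_one hk0]
          exact_mod_cast hj
  have h1 : poissonWeight k k ≤ Real.exp 1 * poissonWeight k (k + j) := by
    refine le_of_mul_le_mul_left ?_ (pow_pos hk0 j)
    calc _ ≤ _ := step j le_rfl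
      _ ≤ k ^ j * Real.exp 1 * poissonWeight k (k + j) :=
        mul_le_mul_of_nonneg_right hexp (hw _).le
      _ = _ := by ring
  have h2 := (poissonWeight_self_ge hk).trans h1
  have h3 : Real.exp 2 = Real.exp 1 * Real.exp 1 := by rw [← Real.exp_add]; norm_num
  rw [inv_le_iff_one_le_mul₀ (by positivity)] at h2 ⊢
  rw [h3]
  linarith

/-- If `A` is the geometric sum, then `A (1 - r) = 1 - r ^ J` and `A ≥ J r ^ J`; the powers `r ^ J`
cancel. -/
lemma le_geom_sum_mul {r : ℝ} (h0 : 0 ≤ r) (h1 : r ≤ 1) (J : ℕ) :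
    J ≤ (∑ j ∈ Finset.range J, r ^ j) * (1 + J * (1 - r)) := by
  have e := geom_sum_mul_neg r J
  have h : J * r ^ J ≤ ∑ j ∈ Finset.range J, r ^ j := by
    have := Finset.card_nsmul_le_sum (Finset.range J) (fun j => r ^ j) (r ^ J) fun j hj =>
      pow_le_pow_of_le_one h0 h1 (Finset.mem_range.1 hj).le
    simpa using this
  nlinarith [Nat.cast_nonneg (α := ℝ) J]

/-- Only the `J ≈ √k` terms just above `k` are kept: there the Poisson masses are of order `1 / √k`,
and a geometric sum remains. -/
lemma inv_le_tsum_tiltedTail {k : ℕ} (hk : 1 ≤ k) {z : ℝ} (hz : 1 ≤ z) :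
    (Real.exp 2 * (1 + √k * (1 - z⁻¹)))⁻¹ ≤ ∑' j, poissonWeight k j * tiltedTail z k j := by
  have hk0 : (0 : ℝ) < k := by exact_mod_cast hk
  have hw := poissonWeight_pos hk0
  have hr0 : 0 ≤ z⁻¹ := by positivity
  have hr1 : z⁻¹ ≤ 1 := inv_le_one_of_one_le₀ hz
  set J := Nat.sqrt k + 1 with hJ
  set A := ∑ j ∈ Finset.range J, z⁻¹ ^ j with hA
  have hsum : Summable fun j => poissonWeight k j * tiltedTail z k j :=
    Summable.of_nonneg_of_le (fun j => mul_nonneg (hw j).le (tiltedTail_nonneg hz k j))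
      (fun j => mul_le_of_le_one_right (hw j).le (tiltedTail_le_one hz k j))
      (hasSum_poissonWeight hk0.le).summable
  have h1 : (Real.exp 2 * √k)⁻¹ * A ≤ ∑' j, poissonWeight k j * tiltedTail z k j := by
    calc (Real.exp 2 * √k)⁻¹ * A
        ≤ ∑ j ∈ Finset.range J, poissonWeight k (k + j) * tiltedTail z k (k + j) := by
          rw [hA, Finset.mul_sum]
          refine Finset.sum_le_sum fun j hj => ?_
          have hj' : j ≤ Nat.sqrt k := Nat.lt_succ_iff.1 (Finset.mem_range.1 hj)
          have : tiltedTail z k (k + j) = z⁻¹ ^ j := by simp [tiltedTail]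
          rw [this]
          gcongr
          exact poissonWeight_add_ge hk (Nat.le_sqrt.1 hj')
      _ = ∑ j ∈ (Finset.range J).map (addLeftEmbedding k),
            poissonWeight k j * tiltedTail z k j := by
          rw [Finset.sum_map]; rfl
      _ ≤ _ := hsum.sum_le_tsum _ fun j _ => mul_nonneg (hw j).le (tiltedTail_nonneg hz k j)
  refine le_trans ?_ h1
  have h2 := le_geom_sum_mul hr0 hr1 J
  have h3 : √(k : ℝ) ≤ J := by
    rw [hJ]
    push_cast
    exact Real.sqrt_le_iff.2 ⟨by positivity, by
      have := Nat.lt_succ_sqrt k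
      have h : (k : ℝ) ≤ (Nat.sqrt k + 1) * (Nat.sqrt k + 1) := by
        exact_mod_cast this.le
      rwa [sq]⟩
  have hs : 0 ≤ 1 - z⁻¹ := by linarith
  have hk' : 0 < √(k : ℝ) := Real.sqrt_pos.2 hk0
  have hJ0 : (0 : ℝ) < J := hk'.trans_le h3
  have h4 : √(k : ℝ) ≤ A * (1 + √k * (1 - z⁻¹)) := by
    have hden : 0 < 1 + J * (1 - z⁻¹) := by positivity
    have e1 : √(k : ℝ) * (1 + J * (1 - z⁻¹)) ≤ J * (1 + √k * (1 - z⁻¹)) := by nlinarith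
    have e2 := mul_le_mul_of_nonneg_right h2 (by positivity : 0 ≤ 1 + √(k : ℝ) * (1 - z⁻¹))
    refine le_of_mul_le_mul_right ?_ hden
    linarith
  rw [mul_inv, mul_inv, mul_assoc]
  gcongr
  rw [inv_mul_eq_div, inv_eq_one_div, div_le_div_iff₀ (by positivity) hk', one_mul]
  exact h4

/-! ### Comparison of the tails -/

lemma poissonWeight_mul_tiltedTail {l z : ℝ} (hz : z ≠ 0) (k j : ℕ) :
    poissonWeight (l * z) j * tiltedTail z k j
      = z ^ k * Real.exp (l - l * z) * (poissonWeight l j * if k ≤ j then 1 else 0) := by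
  have h := pow_mul_tiltedTail hz k j
  have e : Real.exp (-(l * z)) = Real.exp (l - l * z) * Real.exp (-l) := by
    rw [← Real.exp_add]; ring_nf
  unfold poissonWeight
  rw [mul_pow, e]
  linear_combination (Real.exp (l - l * z) * Real.exp (-l) * l ^ j / j.factorial) * h

lemma abs_cycleMean_tiltedTail_sub_le {p z : ℝ} (h0 : 0 ≤ p) (h1 : p ≤ 1) (hz : 1 ≤ z)
    (hpz : p * z ≤ 1 / 2) (m : ℕ) (hm : (p * (z - 1)) ^ m * z ≤ 1) {k : ℕ} (hk : 1 ≤ k)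
    (hkz : (m + 3) * p ^ 2 * z = k) :
    |cycleMean p (m + 3) (fun s => z ^ s * tiltedTail z k s)
        - (∑' j, poissonWeight k j * tiltedTail z k j) * cycleMean p (m + 3) (z ^ ·)|
      ≤ 24 * p * (z + 4 * ((z - 1) * √k)) * cycleMean p (m + 3) (z ^ ·) := by
  have hk1 : (1 : ℝ) ≤ k := by exact_mod_cast hk
  obtain ⟨f, hf, hf1, hf2⟩ := exists_poisson_stein_solution hk1 (tiltedTail_nonneg hz k)
    (tiltedTail_le_one hz k)
  -- The tilt spoils the pure increment of `f`: the extra `(z - 1) f` is paid for by the sup bound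
  -- `4 / √k`, the rest by the increment bound `1 / k`.
  have hs := abs_cycleMean_stein_le h0 h1 hz hpz m hm (f := f)
    (B := z * (1 / k) + (z - 1) * (4 / √k)) fun s => by
      have e : z * f (s + 2) - f (s + 1)
          = z * (f (s + 2) - f (s + 1)) + (z - 1) * f (s + 1) := by ring
      rw [e]
      refine (abs_add_le _ _).trans ?_
      rw [abs_mul, abs_mul, abs_of_nonneg (by linarith : 0 ≤ z),
        abs_of_nonneg (by linarith : 0 ≤ z - 1)]
      have := hf1 s
      have := hf2 s
      have : 0 ≤ z - 1 := by linarith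
      gcongr
  rw [hkz] at hs
  simp only [hf] at hs
  have e1 : cycleMean p (m + 3)
        (fun s => z ^ s * (tiltedTail z k s - ∑' j, poissonWeight k j * tiltedTail z k j))
      = cycleMean p (m + 3) (fun s => z ^ s * tiltedTail z k s)
        - (∑' j, poissonWeight k j * tiltedTail z k j) * cycleMean p (m + 3) (z ^ ·) := by
    rw [← cycleMean_const_mul, ← cycleMean_sub]
    congr 1
    funext s
    ring
  rw [e1] at hs
  refine hs.trans_eq ?_
  congr 1
  have hsq : √(k : ℝ) ^ 2 = k := Real.sq_sqrt (by linarith)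
  have : √(k : ℝ) ≠ 0 := by positivity
  have : (k : ℝ) ≠ 0 := by positivity
  field_simp
  linear_combination (-4 * p * (z - 1)) * hsq

lemma abs_tail_ratio_sub_one_le {p z : ℝ} (h0 : 0 ≤ p) (h1 : p ≤ 1) (hz : 1 ≤ z)
    (hpz : p * z ≤ 1 / 2) (m : ℕ) (hm : (p * (z - 1)) ^ m * z ≤ 1) {k : ℕ} (hk : 1 ≤ k)
    {l : ℝ} (hl : l = (m + 3) * p ^ 2) (hkz : l * z = k)
    (hx : 12 * p * l * (z - 1) ^ 2 ≤ 1) :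
    |cycleMean p (m + 3) (fun s => if k ≤ s then 1 else 0)
        / (∑' j, poissonWeight l j * if k ≤ j then 1 else 0) - 1|
      ≤ 24 * p * l * (z - 1) ^ 2
        + 3 * (24 * p * (z + 4 * ((z - 1) * √k)) * (Real.exp 2 * (1 + √k * (1 - z⁻¹)))) := by
  set R := cycleMean p (m + 3) (fun s => if k ≤ s then 1 else 0)
  set Y := ∑' j, poissonWeight l j * if k ≤ j then 1 else 0
  set G := cycleMean p (m + 3) (z ^ ·) with hG
  set H := ∑' j, poissonWeight k j * tiltedTail z k j with hH
  have hz0 : 0 < z := by linarith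
  have hGpos : 0 < G := cycleMean_pow_pos h0 h1 hz (m + 1)
  have hHY : H = z ^ k * Real.exp (l - k) * Y := by
    rw [hH, ← tsum_mul_left, ← hkz]
    exact tsum_congr fun j => poissonWeight_mul_tiltedTail hz0.ne' k j
  have hR : cycleMean p (m + 3) (fun s => z ^ s * tiltedTail z k s) = z ^ k * R := by
    rw [← cycleMean_const_mul]
    congr 1
    funext s
    exact pow_mul_tiltedTail hz0.ne' k s
  have hstein := abs_cycleMean_tiltedTail_sub_le h0 h1 hz hpz m hm hk (by rw [← hl, hkz])
  rw [hR, ← hH, ← hG] at hstein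
  have hlow := inv_le_tsum_tiltedTail hk hz
  rw [← hH] at hlow
  have hz1 : 0 ≤ 1 - z⁻¹ := by linarith [inv_le_one_of_one_le₀ hz]
  have hV : 0 < Real.exp 2 * (1 + √(k : ℝ) * (1 - z⁻¹)) := by positivity
  set V := Real.exp 2 * (1 + √(k : ℝ) * (1 - z⁻¹))
  have hHpos : 0 < H := (inv_pos.2 hV).trans_le hlow
  have hlog := abs_log_cycleMean_pow_sub_le h0 h1 hz hpz m hm
  rw [← hl, ← hG] at hlog
  set ρ := Real.exp (Real.log G - l * (z - 1)) with hρ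
  have hρ1 : |ρ - 1| ≤ 24 * p * l * (z - 1) ^ 2 := by
    refine (Real.abs_exp_sub_one_le (hlog.trans hx)).trans ?_
    linarith
  have hρ3 : ρ ≤ 3 := by linarith [(abs_le.1 hρ1).2]
  have hρG : ρ = G * Real.exp (l - k) := by
    rw [hρ, ← hkz, show Real.log G - l * (z - 1) = Real.log G + (l - l * z) by ring,
      Real.exp_add, Real.exp_log hGpos]
  set d := (z ^ k * R - H * G) / (H * G) with hd
  have hdle : |d| ≤ 24 * p * (z + 4 * ((z - 1) * √k)) * V := by
    rw [hd, abs_div, abs_of_pos (mul_pos hHpos hGpos), div_le_iff₀ (mul_pos hHpos hGpos)]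
    refine hstein.trans ?_
    have hVH : 1 ≤ V * H := by
      rwa [inv_le_iff_one_le_mul₀ hV, mul_comm] at hlow
    have hX : 0 ≤ 24 * p * (z + 4 * ((z - 1) * √k)) := by
      have : 0 ≤ z - 1 := by linarith
      positivity
    calc _ = 24 * p * (z + 4 * ((z - 1) * √k)) * G * 1 := by ring
      _ ≤ 24 * p * (z + 4 * ((z - 1) * √k)) * G * (V * H) := by gcongr
      _ = _ := by ring
  -- Here `ρ` compares the normalising constants of the two tilts, and `d` is the relative Stein
  -- error.
  have hratio : R / Y = ρ * (1 + d) := by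
    have hzk : z ^ k ≠ 0 := by positivity
    have hexp : Real.exp (l - k) ≠ 0 := (Real.exp_pos _).ne'
    have hY : Y ≠ 0 := by
      rintro h
      rw [h, mul_zero] at hHY
      exact hHpos.ne' hHY
    have hd1 : 1 + d = z ^ k * R / (H * G) := by
      rw [hd]
      have := hHpos.ne'
      have := hGpos.ne'
      field_simp
      ring
    rw [hd1, hρG, hHY]
    have := hGpos.ne'
    field_simp
  rw [hratio, show ρ * (1 + d) - 1 = (ρ - 1) + ρ * d by ring]
  refine (abs_add_le _ _).trans (add_le_add hρ1 ?_)
  rw [abs_mul, abs_of_pos (Real.exp_pos _)]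
  gcongr

/-- For `z ≤ 2` one factor `1 / 2` suffices. For larger `z`, `κ ≥ 1` and `p κ z ≤ 1 / 4` force `(m +
3) p ≥ 4`, so `z` is at most linear in `m` and `2 ^ m` beats it. -/
lemma pow_mul_le_one_of_mass {p z κ : ℝ} (h0 : 0 < p) {m : ℕ} (hm : 1 ≤ m) (hκ : 1 ≤ κ)
    (hz : 1 ≤ z) (hκz : (m + 3) * p ^ 2 * z = κ) (hpz : p * z ≤ 1 / 2)
    (hbig : 2 ≤ z → p * (κ * z) ≤ 1 / 4) : (p * (z - 1)) ^ m * z ≤ 1 := by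
  have hpu0 : 0 ≤ p * (z - 1) := mul_nonneg h0.le (by linarith)
  have hpu : p * (z - 1) ≤ 1 / 2 := by linarith
  rcases le_total z 2 with h | h
  · have h2 : (p * (z - 1)) ^ m ≤ 1 / 2 :=
      (pow_le_of_le_one hpu0 (by linarith) (by omega)).trans hpu
    calc _ ≤ 1 / 2 * z := by gcongr
      _ ≤ 1 := by linarith
  · have h2 : (p * (z - 1)) ^ m ≤ (1 / 2) ^ m := pow_le_pow_left₀ hpu0 hpu m
    have h3 : z ≤ (m + 3) / 8 := by
      have d : κ * (p * z) ≤ 1 / 4 := by linarith [hbig h]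
      have f : p * z ≤ 1 / 4 := (le_mul_of_one_le_left (by positivity) hκ).trans d
      have g : 1 ≤ (m + 3) * p * (p * z) := hκ.trans_eq (by rw [← hκz]; ring)
      have g' : 1 ≤ (m + 3) * p * (1 / 4) := g.trans (by gcongr)
      have i : z ≤ (m + 3) * p * (1 / 4) * z := le_mul_of_one_le_left (by linarith) g'
      have j : (m + 3) * p * (1 / 4) * z = (m + 3) / 4 * (p * z) := by ring
      have l : ((m : ℝ) + 3) / 4 * (p * z) ≤ (m + 3) / 4 * (1 / 2) := by gcongr
      linarith
    have h4 : (m : ℝ) + 1 ≤ 2 ^ m := by exact_mod_cast Nat.lt_two_pow_self (n := m)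
    calc _ ≤ (1 / 2) ^ m * z := by gcongr
      _ ≤ (1 / 2) ^ m * 2 ^ m := by gcongr; linarith
      _ = 1 := by rw [← mul_pow]; norm_num

lemma abs_tail_ratio_sub_one_le_error {p x : ℝ} (h0 : 0 < p) (h1 : p ≤ 1) {m : ℕ} (hm : 1 ≤ m)
    {k : ℕ} {l : ℝ} (hl : l = (m + 3) * p ^ 2) (hk : l ≤ k)
    (hx : x = (k - l) / √l) (he : p + p * x ^ 2 ≤ 1 / 16) :
    |cycleMean p (m + 3) (fun s => if k ≤ s then 1 else 0)
        / (∑' j, poissonWeight l j * if k ≤ j then 1 else 0) - 1|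
      ≤ 11000 * (p + p * x ^ 2) := by
  have hl0 : 0 < l := by rw [hl]; positivity
  have hk0 : (0 : ℝ) < k := hl0.trans_le hk
  have hk1 : 1 ≤ k := by exact_mod_cast hk0
  have hk1' : (1 : ℝ) ≤ k := by exact_mod_cast hk1
  obtain ⟨z, hzdef⟩ : ∃ z, z = k / l := ⟨_, rfl⟩
  have hkz : l * z = k := by rw [hzdef]; field_simp
  have hz : 1 ≤ z := by rw [hzdef]; exact (one_le_div hl0).2 hk
  have hx2 : x ^ 2 = l * (z - 1) ^ 2 := by
    rw [hx, div_pow, Real.sq_sqrt hl0.le, ← hkz]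
    field_simp
  have hbig : 2 ≤ z → l * z ^ 2 ≤ 4 * x ^ 2 := fun h => by
    rw [hx2]
    have : z ^ 2 ≤ 4 * (z - 1) ^ 2 := by nlinarith
    linarith [mul_le_mul_of_nonneg_left this hl0.le]
  have hkz2 : l * z ^ 2 = k * z := by rw [← hkz]; ring
  -- For `z ≥ 2` the tilt is so strong that `z ≤ k z = l z² ≤ 4 x²`, where `k ≥ 1` is essential.
  have hzx : z ≤ 4 * (1 + x ^ 2) := by
    rcases le_total z 2 with h | h
    · linarith [sq_nonneg x]
    · have h2 : z ≤ k * z := le_mul_of_one_le_left (by linarith) hk1'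
      linarith [hbig h]
  have hsq : √(k : ℝ) ^ 2 = k := Real.sq_sqrt hk0.le
  have hux : (z - 1) * √k ≤ 2 * (1 + x ^ 2) := by
    rcases le_total z 2 with h | h
    · refine (abs_le_of_sq_le_sq' ?_ (by positivity)).2
      rw [mul_pow, hsq, ← hkz]
      have : (z - 1) ^ 2 * (l * z) = x ^ 2 * z := by rw [hx2]; ring
      rw [this]
      calc _ ≤ x ^ 2 * 2 := by gcongr
        _ ≤ _ := by nlinarith [sq_nonneg (x ^ 2), sq_nonneg x]
    · have h2 : √(k : ℝ) ≤ k := Real.sqrt_le_iff.2 ⟨hk0.le, by nlinarith⟩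
      have h3 : (z - 1) * √k ≤ (z - 1) * k := mul_le_mul_of_nonneg_left h2 (by linarith)
      have h4 : (z - 1) * k ≤ 2 * x ^ 2 := by
        rw [hx2, ← hkz]
        have : (z - 1) * z ≤ 2 * (z - 1) ^ 2 := by nlinarith
        linarith [mul_le_mul_of_nonneg_left this hl0.le]
      linarith
  set e := p + p * x ^ 2 with hedef
  have he0 : 0 < e := by positivity
  have hee : e = p * (1 + x ^ 2) := by rw [hedef]; ring
  have hpz4 : p * z ≤ 4 * e := by
    rw [hee]
    linarith [mul_le_mul_of_nonneg_left hzx h0.le]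
  have hpz : p * z ≤ 1 / 2 := by linarith
  have hmz : (p * (z - 1)) ^ m * z ≤ 1 := by
    refine pow_mul_le_one_of_mass h0 hm hk1' hz (by rw [← hl, hkz]) hpz fun h => ?_
    have a := mul_le_mul_of_nonneg_left (hbig h) h0.le
    rw [hkz2] at a
    linarith
  have hpx : p * l * (z - 1) ^ 2 ≤ e := by
    have : p * l * (z - 1) ^ 2 = p * x ^ 2 := by rw [hx2]; ring
    linarith
  have main := abs_tail_ratio_sub_one_le h0.le h1 hz hpz m hmz hk1 hl hkz (by linarith)
  refine main.trans ?_
  have hexp : Real.exp 2 ≤ 8 := by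
    have : Real.exp 2 = Real.exp 1 * Real.exp 1 := by rw [← Real.exp_add]; norm_num
    rw [this]
    nlinarith [Real.exp_one_lt_d9, Real.exp_pos 1]
  -- The product expands to `z + 5 (z - 1) √k + 4 x²`, at most `(4 + 10 + 4) (1 + x²)`.
  have hprod : (z + 4 * ((z - 1) * √k)) * (1 + √k * (1 - z⁻¹)) ≤ 18 * (1 + x ^ 2) := by
    have e1 : z * (√k * (1 - z⁻¹)) = (z - 1) * √k := by field_simp
    have e2 : ((z - 1) * √k) * (√k * (1 - z⁻¹)) = x ^ 2 := by
      have : ((z - 1) * √k) * (√k * (1 - z⁻¹)) = √k ^ 2 * ((z - 1) * (1 - z⁻¹)) := by ring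
      rw [this, hsq, hx2, ← hkz]
      field_simp
    have e3 : (z + 4 * ((z - 1) * √k)) * (1 + √k * (1 - z⁻¹))
        = z + 4 * ((z - 1) * √k) + z * (√k * (1 - z⁻¹))
          + 4 * (((z - 1) * √k) * (√k * (1 - z⁻¹))) := by ring
    rw [e3, e1, e2]
    linarith [sq_nonneg x]
  have hfin : 24 * p * (z + 4 * ((z - 1) * √k)) * (Real.exp 2 * (1 + √k * (1 - z⁻¹)))
      ≤ 3456 * e := by
    calc _ = 24 * Real.exp 2 * p * ((z + 4 * ((z - 1) * √k)) * (1 + √k * (1 - z⁻¹))) := by ring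
      _ ≤ 24 * Real.exp 2 * p * (18 * (1 + x ^ 2)) := by gcongr
      _ ≤ 24 * 8 * p * (18 * (1 + x ^ 2)) := by gcongr
      _ = _ := by rw [hee]; ring
  -- The total constant is `24 + 3 * 3456 = 10392`.
  linarith

/-! ### Identification of the laws -/

lemma poissonMeasure_real_Ici (r : NNReal) (k : ℕ) :
    (poissonMeasure r).real (Set.Ici k) = ∑' j, poissonWeight r j * if k ≤ j then 1 else 0 := by
  rw [← integral_indicator_one (measurableSet_Ici), integral_poissonMeasure]
  refine tsum_congr fun j => ?_
  simp [poissonWeight, Set.indicator_apply]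

lemma bernoulliMeasure_real_bit (p : unitInterval) (a : Fin 2) :
    (bernoulliMeasure (1 : Fin 2) 0 p).real {a} = bitWeight p a := by
  fin_cases a <;> simp

lemma measureReal_le_twoRuns {Ω : Type*} [MeasurableSpace Ω] (P : Measure Ω)
    [IsProbabilityMeasure P] (n : ℕ) (p : unitInterval) (ξ : Fin n → Ω → ℕ)
    (hξ : ∀ i, HasLaw (ξ i) (bernoulliMeasure 1 0 p) P) (hind : iIndepFun ξ P) (k : ℕ) :
    P.real {ω | k ≤ twoRuns ξ ω} = cycleMean p n (fun s => if k ≤ s then 1 else 0) := by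
  -- Moving the joint law to words over `Fin 2` turns the probability into a finite sum.
  let ν : Measure (Fin 2) := bernoulliMeasure 1 0 p
  let A : Set (Fin n → ℕ) := {x | k ≤ ∑ i, x i * x (finRotate n i)}
  have hν : ν.map (fun a : Fin 2 => (a : ℕ)) = bernoulliMeasure 1 0 p := by
    simp [ν]
  have hmap : P.map (fun ω i => ξ i ω)
      = (Measure.pi fun _ => ν).map fun (x : Fin n → Fin 2) i => (x i : ℕ) := by
    rw [(iIndepFun_iff_map_fun_eq_pi_map fun i => (hξ i).aemeasurable).1 hind]
    simp only [(hξ _).map_eq, ← hν]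
    exact (Measure.pi_map_pi fun i => (measurable_of_countable _).aemeasurable).symm
  have hA : MeasurableSet A := A.to_countable.measurableSet
  have h1 : P.real {ω | k ≤ twoRuns ξ ω} = (P.map fun ω i => ξ i ω).real A :=
    (map_measureReal_apply_of_aemeasurable
      (aemeasurable_pi_lambda _ fun i => (hξ i).aemeasurable) hA).symm
  rw [h1, hmap, map_measureReal_apply (measurable_of_countable _) hA,
    ← integral_indicator_one ((Set.to_countable _).measurableSet),
    integral_fintype (.of_finite)]
  refine Finset.sum_congr rfl fun x _ => ?_
  rw [smul_eq_mul]
  congr 1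
  · rw [measureReal_def, Measure.pi_singleton, ENNReal.toReal_prod]
    exact Finset.prod_congr rfl fun i _ => bernoulliMeasure_real_bit p (x i)
  · simp [Set.indicator_apply, A, cycleRuns]

theorem mainTheorem5 :
    ∃ c : ℝ, 0 < c ∧ ∃ C : ℝ, 0 < C ∧
      ∀ (Ω : Type*) [MeasurableSpace Ω] (P : Measure Ω) [IsProbabilityMeasure P]
        (n : ℕ) (p : unitInterval) (ξ : Fin n → Ω → ℕ),
        10 < n → 0 < (p : ℝ) → (p : ℝ) < 1 / 2 →
        (∀ i, HasLaw (ξ i) (bernoulliMeasure 1 0 p) P) → iIndepFun ξ P →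
        ∀ k : ℕ, (twoRunsMean n p : ℝ) ≤ k → twoRunsError n p k ≤ c →
          |P.real {ω | k ≤ twoRuns ξ ω} / (poissonMeasure (twoRunsMean n p)).real (Set.Ici k) - 1|
            ≤ C * twoRunsError n p k := by
  refine ⟨1 / 16, by norm_num, 11000, by norm_num, ?_⟩
  intro Ω _ P _ n p ξ hn hp0 hp1 hξ hind k hk herr
  rw [measureReal_le_twoRuns P n p ξ hξ hind, poissonMeasure_real_Ici]
  obtain ⟨m, rfl⟩ := Nat.exists_eq_add_of_le' (show 3 ≤ n by omega)
  have hx0 : 0 ≤ twoRunsXi (m + 3) p k :=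
    div_nonneg (by linarith) (Real.sqrt_nonneg _)
  have hcube : 0 ≤ twoRunsXi (m + 3) p k ^ 3 / √((m + 3 : ℕ) : ℝ) := by positivity
  have hle : (p : ℝ) + p * twoRunsXi (m + 3) p k ^ 2 ≤ twoRunsError (m + 3) p k :=
    le_add_of_nonneg_right hcube
  have hmean : (twoRunsMean (m + 3) p : ℝ) = (m + 3) * (p : ℝ) ^ 2 := by
    simp [twoRunsMean]
  refine (abs_tail_ratio_sub_one_le_error hp0 (by linarith) (by omega) hmean hk rfl
    (hle.trans herr)).trans ?_
  exact mul_le_mul_of_nonneg_left hle (by norm_num)
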